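/- For a differentiable $f:\mathbb{R}\to\mathbb{R}$, $x_0\in\mathbb{R}$ and $\eta>0$, let $\mathrm{NAG}(f,x_0,t,\eta)=(x_t,y_t)$ be the iterates given by $y_0=x_0$ and, for $t\ge 1$, $$x_t=y_{t-1}-\eta\nabla f(y_{t-1}),\qquad y_t=x_t+\gamma_t(x_t-x_{t-1}),\qquad \gamma_t=\tfrac{t-1}{t+2}.$$ For a loss $\ell:\mathbb{R}\times\mathcal{Z}\to\mathbb{R}$ and $S=(z_1,\dots,z_n)\in\mathcal{Z}^n$ let $R_S(w)=\frac1n\sum_{i=1}^n\ell(w;z_i)$. The $T$-step full-batch method $\mathrm{NAG}_T$ with step size $\eta$, started at $x_0$, maps $S$ to the iterate $x_T$ of $\mathrm{NAG}(R_S,x_0,T,\eta)$. Its uniform stability $\delta^{\mathrm{unif}}_{\mathrm{NAG}_T,\ell}(n)$ is the infimum of all $\epsilon>0$ such that $\sup_{z\in\mathcal{Z}}|\ell(\mathrm{NAG}_T(S);z)-\ell(\mathrm{NAG}_T(S');z)|\le\epsilon$ for all $S,S'\in\mathcal{Z}^n$ that differ in at most one example. A function is $\beta$-smooth if it is differentiable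 with $\beta$-Lipschitz gradient. **Theorem.** (a) There are universal constants $c_3,c_4>0$ such that for all $G,\beta>0$, $0<\eta\le 1/\beta$, $n\ge 4$ and every starting point $x_0\in\mathbb{R}$ there are a sample space $\mathcal{Z}$ and a loss $\ell:\mathbb{R}\times\mathcal{Z}\to\mathbb{R}$, convex, $\beta$-smooth and $G$-Lipschitz in $w$ for every $z\in\mathcal{Z}$, with $$\delta^{\mathrm{unif}}_{\mathrm{NAG}_T,\ell}(n)\ \ge\ \min\Big\{\tfrac{G^2}{3\beta},\ c_4e^{c_3\eta\beta T}\,\tfrac{\beta\eta^2G^2}{n}\Big\}\qquad\text{for all } T\in\Big\{\Big\lceil\tfrac{10}{\eta\beta}\tfrac{n}{n-3}\Big\rceil(i+2):\ i=1,2,\dots\Big\}.$$ Furthermore, for the same loss, $\delta^{\mathrm{unif}}_{\mathrm{NAG}_T,\ell}(n)\ge\frac{G^2}{3\beta}$ for all integers $T\ge\big\lceil\tfrac{40}{\eta\beta}\big\rceil\big(\ln\tfrac{6n}{\eta^2\beta^2}+3\big)$. (b) Consequently the uniform stability is not $O(T^2/n)$ in the general convex smooth setting: for all $G,\beta>0$,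 $0<\eta\le1/\beta$ and $x_0\in\mathbb{R}$ there is no constant $C$ such that $\delta^{\mathrm{unif}}_{\mathrm{NAG}_T,\ell}(n)\le C\,T^2/n$ for all $n,T\ge1$, all sample spaces $\mathcal{Z}$ and all losses $\ell:\mathbb{R}\times\mathcal{Z}\to\mathbb{R}$ that are convex, $\beta$-smooth and $G$-Lipschitz in $w$. -/

import Mathlib

noncomputable section

/-- `f` is `β`-smooth: it is differentiable and its gradient is `β`-Lipschitz. -/
def IsBetaSmooth {E : Type*} [NormedAddCommGroup E] [InnerProductSpace ℝ E] [CompleteSpace E]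
    (β : ℝ) (f : E → ℝ) : Prop :=
  Differentiable ℝ f ∧ ∀ u v : E, ‖gradient f u - gradient f v‖ ≤ β * ‖u - v‖

/-- `f` is `G`-Lipschitz. -/
def IsLipschitzConst {E : Type*} [NormedAddCommGroup E] (G : ℝ) (f : E → ℝ) : Prop :=
  ∀ u v : E, |f u - f v| ≤ G * ‖u - v‖

/-- A loss `ℓ w z` that is convex, `β`-smooth and `G`-Lipschitz in `w` for every example `z`. -/
def IsAdmissibleLoss {E Z : Type*} [NormedAddCommGroup E] [InnerProductSpace ℝ E] [CompleteSpace E]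
    (G β : ℝ) (ℓ : E → Z → ℝ) : Prop :=
  ∀ z : Z, ConvexOn ℝ Set.univ (fun w => ℓ w z) ∧ IsBetaSmooth β (fun w => ℓ w z) ∧
    IsLipschitzConst G (fun w => ℓ w z)

/-- The momentum coefficient `γ_t = (t - 1) / (t + 2)`. -/
def nagGamma (t : ℕ) : ℝ := ((t : ℝ) - 1) / ((t : ℝ) + 2)

/-- The iterates `(x_t, y_t)` of Nesterov's accelerated gradient method on `f` with step size `η`
started at `x₀`: `x_0 = y_0 = x₀` and, for `t ≥ 1`,
`x_t = y_{t-1} - η ∇f(y_{t-1})`, `y_t = x_t + γ_t (x_t - x_{t-1})`. -/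
def nag {E : Type*} [NormedAddCommGroup E] [InnerProductSpace ℝ E] [CompleteSpace E]
    (f : E → ℝ) (x₀ : E) (η : ℝ) : ℕ → E × E
  | 0 => (x₀, x₀)
  | t + 1 =>
    let x := (nag f x₀ η t).2 - η • gradient f (nag f x₀ η t).2
    (x, x + nagGamma (t + 1) • (x - (nag f x₀ η t).1))

/-- The empirical risk `R_S(w) = (1/n) ∑ i, ℓ(w; z_i)` of the sample `S = (z_1, …, z_n)`. -/
def empiricalRisk {E Z : Type*} {n : ℕ} (ℓ : E → Z → ℝ) (S : Fin n → Z) (w : E) : ℝ :=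
  (1 / (n : ℝ)) * ∑ i, ℓ w (S i)

/-- `T`-step full-batch NAG: it maps a sample `S` to the iterate `x_T` of NAG on the empirical
risk of `S`. -/
def fullBatchNAG {E Z : Type*} [NormedAddCommGroup E] [InnerProductSpace ℝ E] [CompleteSpace E]
    {n : ℕ} (ℓ : E → Z → ℝ) (x₀ : E) (η : ℝ) (T : ℕ) (S : Fin n → Z) : E :=
  (nag (empiricalRisk ℓ S) x₀ η T).1

/-- The algorithm `A` is `ε`-uniformly stable: for all samples `S`, `S'` of size `n` that differ in
at most one example, `|ℓ(A(S); z) - ℓ(A(S'); z)| ≤ ε` for every example `z`. -/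
def IsUniformlyStable {E Z : Type*} {n : ℕ} (ℓ : E → Z → ℝ) (A : (Fin n → Z) → E) (ε : ℝ) : Prop :=
  ∀ S S' : Fin n → Z, {i | S i ≠ S' i}.Subsingleton → ∀ z : Z, |ℓ (A S) z - ℓ (A S') z| ≤ ε

/-- The uniform stability of `A`: the infimum of all `ε > 0` for which `A` is `ε`-uniformly
stable (an extended real, equal to `⊤` if there is no such `ε`). -/
def uniformStability {E Z : Type*} {n : ℕ} (ℓ : E → Z → ℝ) (A : (Fin n → Z) → E) : EReal :=
  sInf ((fun ε : ℝ => (ε : EReal)) '' {ε : ℝ | 0 < ε ∧ IsUniformlyStable ℓ A ε})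

end

/-! Momentum overshoots when curvature is met only now and then. Suppose two trajectories deviate by
`D` and both meet curvature `β/2` in a single step. This adds about `-κ * D` to their relative
velocity, where `κ = ηβ/2`. On the flat stretch that follows, momentum decays only polynomially, so
from a time `s ≥ N` a unit of velocity carries the deviation over at least `7/20 * N` in `N` steps.
Once `κ * N ≥ 20` the deviation changes sign and grows at least fourfold (`abs_amplify`,
`IsAmplified.step`), so `m` such kicks, `N` steps apart, amplify by `4 ^ m`.

The curvature must depend on position, not on time. The deviation recursion does not involve the
trajectory, so the deviations are known beforehand, and with them the intervals around the `y_t` on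
which the slope must rise, the gradients met, and the base trajectory itself. Kicked deviations grow
geometrically, so the total rise is a small part of `G`. The gradient met on the base trajectory
therefore stays below `-G/4`, the iterates accelerate to the right, and the intervals are disjoint
(`exists_unstable_trajectories`).

The initial deviation, at most of order `βη²G/n`, comes from changing one example to the left of
`y_1`, a region that is visited only at the start (`exists_samples`). Taking all admissible slopes
as examples makes the loss independent of `T`, while the two samples may depend on `T`. A linear
example of slope `G` turns distance into loss. For (b), logarithmically many steps in `n` already
give a constant gap. -/

noncomputable section

/-! ### Growth of the deviation under periodic kicks -/

/-- The dimensionless curvature `κ` met at time `t`: it is `κ` at the positive multiples of `N` up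
to `m * N`, and zero at all other times. -/
def kick (κ : ℝ) (N m t : ℕ) : ℝ := if N ∣ t ∧ 0 < t ∧ t ≤ m * N then κ else 0

/-- The deviation of two NAG trajectories that meet the curvature `kick κ N m t` at time `t`: the
deviation of `y_t`, and its excess over the deviation of `x_t`. -/
def deviation (κ : ℝ) (N m : ℕ) : ℕ → ℝ × ℝ
  | 0 => (1, 0)
  | t + 1 =>
    let U := nagGamma (t + 1) *
      ((deviation κ N m t).2 - kick κ N m t * (deviation κ N m t).1)
    ((1 - kick κ N m t) * (deviation κ N m t).1 + U, U)

/-- The momentum surviving `k` steps after time `s`. -/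
def momentumDecay (s k : ℝ) : ℝ :=
  s * (s + 1) * (s + 2) / ((s + k) * (s + k + 1) * (s + k + 2))

/-- The displacement caused by a unit of velocity in `k` steps after time `s`. -/
def momentumReach (s k : ℝ) : ℝ :=
  s / 2 * (1 - (s + 1) * (s + 2) / ((s + k + 1) * (s + k + 2)))

lemma kick_of_not {κ : ℝ} {N m t : ℕ} (h : ¬ (N ∣ t ∧ 0 < t ∧ t ≤ m * N)) :
    kick κ N m t = 0 := if_neg h

lemma kick_mul {κ : ℝ} {N m j : ℕ} (hN : 0 < N) (hj : 0 < j) (hjm : j ≤ m) :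
    kick κ N m (j * N) = κ :=
  if_pos ⟨dvd_mul_left N j, Nat.mul_pos hj hN, Nat.mul_le_mul_right N hjm⟩

lemma kick_eq_zero_of_lt {κ : ℝ} {N m t : ℕ} (h : t < N) : kick κ N m t = 0 :=
  kick_of_not fun ⟨h1, h2, _⟩ => absurd (Nat.le_of_dvd h2 h1) (by omega)

lemma kick_eq_zero_of_gt {κ : ℝ} {N m t : ℕ} (h : m * N < t) : kick κ N m t = 0 :=
  kick_of_not fun ⟨_, _, h3⟩ => by omega

lemma kick_eq_zero_between {κ : ℝ} {N m j t : ℕ} (h1 : j * N < t) (h2 : t < (j + 1) * N) :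
    kick κ N m t = 0 :=
  kick_of_not fun ⟨⟨c, hc⟩, _, _⟩ => by
    subst hc
    rw [mul_comm N c] at h1 h2
    have := lt_of_mul_lt_mul_right h1 (Nat.zero_le N)
    have := lt_of_mul_lt_mul_right h2 (Nat.zero_le N)
    omega

lemma momentumDecay_nonneg {s k : ℝ} (hs : 0 ≤ s) (hk : 0 ≤ k) : 0 ≤ momentumDecay s k := by
  unfold momentumDecay; positivity

lemma momentumDecay_le_one {s k : ℝ} (hs : 0 ≤ s) (hk : 0 ≤ k) : momentumDecay s k ≤ 1 := by
  unfold momentumDecay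
  apply div_le_one_of_le₀ _ (by positivity)
  gcongr <;> linarith

lemma momentumDecay_succ {s k : ℝ} (hs : 0 < s) (hk : 0 ≤ k) :
    momentumDecay s (k + 1) = (s + k) / (s + k + 3) * momentumDecay s k := by
  unfold momentumDecay
  have : s + k ≠ 0 := by positivity
  have : s + k + 1 ≠ 0 := by positivity
  have : s + k + 2 ≠ 0 := by positivity
  have : s + k + 3 ≠ 0 := by positivity
  rw [show s + (k + 1) = s + k + 1 by ring, show s + k + 1 + 1 = s + k + 2 by ring,
    show s + k + 1 + 2 = s + k + 3 by ring]
  field_simp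

lemma momentumReach_succ {s k : ℝ} (hs : 0 < s) (hk : 0 ≤ k) :
    momentumReach s (k + 1) = momentumReach s k + momentumDecay s (k + 1) := by
  unfold momentumReach momentumDecay
  have : s + k + 1 ≠ 0 := by positivity
  have : s + k + 2 ≠ 0 := by positivity
  have : s + k + 3 ≠ 0 := by positivity
  rw [show s + (k + 1) = s + k + 1 by ring, show s + k + 1 + 1 = s + k + 2 by ring,
    show s + k + 1 + 2 = s + k + 3 by ring]
  field_simp
  ring

lemma momentumReach_zero {s : ℝ} (hs : 0 < s) : momentumReach s 0 = 0 := by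
  unfold momentumReach
  have : s + 1 ≠ 0 := by positivity
  have : s + 2 ≠ 0 := by positivity
  simp only [add_zero]
  field_simp
  ring

lemma monotone_momentumReach {s : ℝ} (hs : 0 < s) :
    Monotone fun k : ℕ => momentumReach s k := by
  refine monotone_nat_of_le_succ fun k => ?_
  push_cast
  rw [momentumReach_succ hs (Nat.cast_nonneg k)]
  linarith [momentumDecay_nonneg hs.le (by positivity : (0 : ℝ) ≤ (k : ℝ) + 1)]

/-- The worst case is `s = N`, where the reach is close to `3N/8`. The bound needs `N ≤ s` because
velocity acquired early is damped before it travels far. -/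
lemma le_momentumReach {s N : ℝ} (hN : 40 ≤ N) (hs : N ≤ s) :
    7 / 20 * N ≤ momentumReach s N := by
  have hN0 : 0 < N := by linarith
  have hs0 : 0 < s := by linarith
  unfold momentumReach
  have h1 : 0 < (s + N + 1) * (s + N + 2) := by positivity
  have : s / 2 * (1 - (s + 1) * (s + 2) / ((s + N + 1) * (s + N + 2)))
      = N * (s * (2 * s + N + 3)) / (2 * ((s + N + 1) * (s + N + 2))) := by
    have : s + N + 1 ≠ 0 := by positivity
    have : s + N + 2 ≠ 0 := by positivity
    field_simp
    ring
  rw [this, le_div_iff₀ (by positivity)]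
  have h2 : 7 / 10 * ((s + N + 1) * (s + N + 2)) ≤ s * (2 * s + N + 3) := by
    obtain ⟨d, rfl⟩ : ∃ d, s = N + d := ⟨s - N, by ring⟩
    have hd : 0 ≤ d := by linarith
    nlinarith [mul_nonneg hd (by linarith : (0 : ℝ) ≤ N), mul_self_nonneg d]
  nlinarith

lemma deviation_eq_of_forall_kick {κ : ℝ} {N m t : ℕ} (h : ∀ s < t, kick κ N m s = 0) :
    deviation κ N m t = (1, 0) := by
  induction t with
  | zero => rfl
  | succ t ih =>
    simp [deviation, ih fun s hs => h s (by omega), h t (by omega)]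

lemma nagGamma_succ (t : ℕ) : nagGamma (t + 1) = (t : ℝ) / ((t : ℝ) + 3) := by
  unfold nagGamma
  push_cast
  congr 1 <;> ring

/-- The deviation after a kick at time `s`, as long as no other kick occurs. -/
lemma deviation_after_kick {κ : ℝ} {N m s : ℕ} (hs : 0 < s) (hks : kick κ N m s = κ) (k : ℕ)
    (h : ∀ i, s < i → i < s + k + 1 → kick κ N m i = 0) :
    deviation κ N m (s + k + 1) =
      ((1 - κ) * (deviation κ N m s).1 + ((deviation κ N m s).2 - κ * (deviation κ N m s).1) *
          momentumReach s (k + 1),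
        ((deviation κ N m s).2 - κ * (deviation κ N m s).1) * momentumDecay s (k + 1)) := by
  have hs' : (0 : ℝ) < s := by exact_mod_cast hs
  induction k with
  | zero =>
    have hP : momentumDecay s (0 + 1) = (s : ℝ) / (s + 3) := by
      rw [momentumDecay_succ hs' le_rfl]
      unfold momentumDecay
      field_simp
      ring
    simp only [Nat.cast_zero]
    rw [momentumReach_succ hs' le_rfl, momentumReach_zero hs', hP]
    simp only [deviation, hks, nagGamma_succ]
    ext <;> simp only <;> ring
  | succ k ih =>
    have hP := momentumDecay_succ hs' (by positivity : (0 : ℝ) ≤ (k : ℝ) + 1)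
    have hA := momentumReach_succ hs' (by positivity : (0 : ℝ) ≤ (k : ℝ) + 1)
    push_cast
    rw [hA, hP]
    rw [show s + (k + 1) + 1 = (s + k + 1) + 1 by ring, deviation,
      ih fun i h1 h2 => h i h1 (by omega), h (s + k + 1) (by omega) (by omega), nagGamma_succ]
    push_cast
    ext <;> simp only <;> ring

/-- Old momentum `U` has the sign of `D` and cancels at most a quarter of the kick, so the new
velocity opposes `D` with size at least `3/4 * κ * |D|`. A reach of `7/κ` moves the deviation by
`21/4 * |D|`, past zero to more than `4 * |D|`. The velocity left over is small compared with the
new deviation and has its sign, so the hypotheses recur. -/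
lemma abs_amplify {κ D U A : ℝ} (hκ : 0 < κ) (hκ1 : κ ≤ 1) (hUD : 0 ≤ U * D)
    (hU : |U| ≤ κ / 4 * |D|) (hA : 7 ≤ κ * A) :
    4 * |D| ≤ |(1 - κ) * D + (U - κ * D) * A| ∧
    (∀ P, 0 ≤ P → P ≤ 1 →
      0 ≤ (U - κ * D) * P * ((1 - κ) * D + (U - κ * D) * A) ∧
      |(U - κ * D) * P| ≤ κ / 4 * |(1 - κ) * D + (U - κ * D) * A|) ∧
    ∀ A', 0 ≤ A' → A' ≤ A →
      |(1 - κ) * D + (U - κ * D) * A'| ≤ |(1 - κ) * D + (U - κ * D) * A| := by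
  wlog hD : 0 ≤ D generalizing D U
  · have := this (D := -D) (U := -U) (by simpa using hUD) (by simpa using hU) (by linarith)
    have e : ∀ B, (1 - κ) * -D + -((U - κ * D) * B) = -((1 - κ) * D + (U - κ * D) * B) :=
      fun B => by ring
    have e' : ∀ P, (-U - κ * -D) * P = -((U - κ * D) * P) := fun P => by ring
    simpa only [e', e, abs_neg, neg_mul_neg] using this
  have hA0 : 0 < A := by
    by_contra hcon
    nlinarith
  rw [abs_of_nonneg hD] at hU
  have hU0 : 0 ≤ U := by
    rcases hD.eq_or_lt with h | h
    · subst h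
      have : U = 0 := by simpa using hU
      exact this.ge
    · exact nonneg_of_mul_nonneg_left hUD h
  rw [abs_of_nonneg hU0] at hU
  set ω := κ * D - U with hω
  have e : U - κ * D = -ω := by rw [hω]; ring
  have hω1 : 3 / 4 * (κ * D) ≤ ω := by rw [hω]; linarith
  have hκD : 0 ≤ κ * D := by positivity
  have hω0 : 0 ≤ ω := by linarith
  have hωA : 21 / 4 * D ≤ ω * A := by nlinarith
  have hωκ : 7 * ω ≤ κ * (ω * A) := by nlinarith
  have hlow : 0 ≤ (1 - κ) * D := mul_nonneg (by linarith) hD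
  have hlow' : (1 - κ) * D ≤ D := by nlinarith
  have habs : |(1 - κ) * D + (U - κ * D) * A| = ω * A - (1 - κ) * D := by
    rw [e, abs_of_nonpos (by linarith)]
    ring
  rw [habs]
  refine ⟨by rw [abs_of_nonneg hD]; linarith, fun P hP0 hP1 => ⟨?_, ?_⟩, fun A' h0 h1 => ?_⟩
  · have : (U - κ * D) * P * ((1 - κ) * D + (U - κ * D) * A)
        = (ω * P) * (ω * A - (1 - κ) * D) := by rw [e]; ring
    rw [this]
    exact mul_nonneg (by positivity) (by linarith)
  · rw [e, abs_of_nonpos (by nlinarith)]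
    have : ω * P ≤ ω := by nlinarith
    nlinarith
  · have h2 : ω * A' ≤ ω * A := by gcongr
    have h3 : 0 ≤ ω * A' := by positivity
    rw [e, abs_le]
    constructor <;> linarith

/-- At time `t`, after `j` amplifications, the deviation is large and dominates its past. -/
structure IsAmplified (κ : ℝ) (N m t j : ℕ) : Prop where
  growth : 4 ^ j ≤ |(deviation κ N m t).1|
  sign : 0 ≤ (deviation κ N m t).2 * (deviation κ N m t).1
  slow : |(deviation κ N m t).2| ≤ κ / 4 * |(deviation κ N m t).1|
  past : ∀ i ≤ t, |(deviation κ N m i).1| ≤ |(deviation κ N m t).1|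
  kicks : 3 * ∑ i ∈ Finset.range t, kick κ N m i * |(deviation κ N m i).1|
    ≤ κ * |(deviation κ N m t).1|

lemma isAmplified_zero {κ : ℝ} {N m t : ℕ} (hκ : 0 < κ) (h : ∀ s < t, kick κ N m s = 0) :
    IsAmplified κ N m t 0 := by
  have ht := deviation_eq_of_forall_kick h
  refine ⟨by simp [ht], by simp [ht], by simp [ht]; positivity, fun i hi => ?_, ?_⟩
  · rw [ht, deviation_eq_of_forall_kick fun s hs => h s (by omega)]
  · rw [Finset.sum_eq_zero fun i hi => by rw [h i (Finset.mem_range.1 hi), zero_mul]]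
    simp [ht, hκ.le]

lemma IsAmplified.step {κ : ℝ} {N m s j k : ℕ} (hκ : 0 < κ) (hκ1 : κ ≤ 1) (hN : 40 ≤ N)
    (hκN : 20 ≤ κ * N) (hs : N ≤ s) (hks : kick κ N m s = κ) (hk : N ≤ k)
    (h : ∀ i, s < i → i < s + k → kick κ N m i = 0) (H : IsAmplified κ N m s j) :
    IsAmplified κ N m (s + k) (j + 1) := by
  have hs0 : 0 < s := by omega
  have hs0' : (0 : ℝ) < s := by exact_mod_cast hs0
  have hdev : ∀ i, 1 ≤ i → i ≤ k → deviation κ N m (s + i) =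
      ((1 - κ) * (deviation κ N m s).1 + ((deviation κ N m s).2 - κ * (deviation κ N m s).1) *
          momentumReach s i,
        ((deviation κ N m s).2 - κ * (deviation κ N m s).1) * momentumDecay s i) := by
    intro i h1 h2
    obtain ⟨i, rfl⟩ : ∃ i', i = i' + 1 := ⟨i - 1, by omega⟩
    have := deviation_after_kick hs0 hks i fun l h3 h4 => h l h3 (by omega)
    rw [← add_assoc, this]
    push_cast
    rfl
  have hmono := monotone_momentumReach hs0'
  have hA : 7 ≤ κ * momentumReach s k := by
    have h1 : 7 / 20 * (N : ℝ) ≤ momentumReach s N :=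
      le_momentumReach (by exact_mod_cast hN) (by exact_mod_cast hs)
    have h2 : momentumReach s N ≤ momentumReach s k := hmono hk
    nlinarith
  obtain ⟨g1, g2, g3⟩ := abs_amplify hκ hκ1 H.sign H.slow hA
  obtain ⟨g4, g5⟩ := g2 (momentumDecay s k) (momentumDecay_nonneg hs0'.le (Nat.cast_nonneg k))
    (momentumDecay_le_one hs0'.le (Nat.cast_nonneg k))
  have hk' := hdev k (by omega) le_rfl
  have hgrow : 4 * |(deviation κ N m s).1| ≤ |(deviation κ N m (s + k)).1| := by rw [hk']; exact g1
  refine ⟨?_, by rw [hk']; exact g4, by rw [hk']; exact g5, fun i hi => ?_, ?_⟩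
  · rw [pow_succ]
    linarith [H.growth]
  · rcases Nat.lt_or_ge s i with hsi | hsi
    · obtain ⟨l, rfl⟩ : ∃ l, i = s + l := ⟨i - s, by omega⟩
      rw [hdev l (by omega) (by omega), hk']
      refine g3 _ ?_ (hmono (by omega : l ≤ k))
      have := hmono (Nat.zero_le l)
      simp only [Nat.cast_zero, momentumReach_zero hs0'] at this
      exact this
    · linarith [H.past i hsi, abs_nonneg (deviation κ N m s).1]
  · have h1 : ∑ i ∈ Finset.range (s + k), kick κ N m i * |(deviation κ N m i).1|
        = ∑ i ∈ Finset.range (s + 1), kick κ N m i * |(deviation κ N m i).1| := by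
      symm
      apply Finset.sum_subset
      · intro i hi
        simp only [Finset.mem_range] at *
        omega
      · intro i hi hi'
        simp only [Finset.mem_range] at hi hi'
        rw [h i (by omega) hi, zero_mul]
    rw [h1, Finset.sum_range_succ, hks]
    -- A geometric series: the old sum and the new term are at most `(1/3 + 1) * κ * |D|`, and the
    -- deviation has grown by a factor of at least 4.
    nlinarith [H.kicks]

lemma isAmplified_mul {κ : ℝ} {N m : ℕ} (hκ : 0 < κ) (hκ1 : κ ≤ 1) (hN : 40 ≤ N)
    (hκN : 20 ≤ κ * N) (j : ℕ) (hj : j ≤ m) : IsAmplified κ N m ((j + 1) * N) j := by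
  induction j with
  | zero =>
    exact isAmplified_zero hκ fun s hs => kick_eq_zero_of_lt (by simpa using hs)
  | succ j ih =>
    have := (ih (by omega)).step (k := N) hκ hκ1 hN hκN (Nat.le_mul_of_pos_left N (by omega))
      (kick_mul (by omega) (by omega) hj) le_rfl
      fun i h1 h2 => kick_eq_zero_between h1 (by rw [add_mul (j + 1)]; omega)
    convert this using 1
    ring

/-- After the last kick any wait of at least `N` steps suffices, so the final time need not be a
multiple of `N`. -/
lemma isAmplified_final {κ : ℝ} {N m T : ℕ} (hκ : 0 < κ) (hκ1 : κ ≤ 1) (hN : 40 ≤ N)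
    (hκN : 20 ≤ κ * N) (hm : m = 0 ∨ (m + 1) * N ≤ T) : IsAmplified κ N m T m := by
  rcases m with _ | m
  · refine isAmplified_zero hκ fun s _ => kick_of_not fun ⟨_, h2, h3⟩ => by omega
  · have hT : (m + 2) * N ≤ T := by simpa using hm
    have hT' : (m + 2) * N = (m + 1) * N + N := by ring
    have := (isAmplified_mul (m := m + 1) hκ hκ1 hN hκN m (by omega)).step
      (k := T - (m + 1) * N) hκ hκ1 hN hκN
      (Nat.le_mul_of_pos_left N (by omega)) (kick_mul (by omega) (by omega) le_rfl)
      (by omega) fun i h1 h2 => kick_eq_zero_of_gt h1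
    rwa [Nat.add_sub_cancel' (by omega)] at this

/-! ### Functions that rise only on a sequence of intervals -/

/-- The length of the part of `⋃ s < T, [L s, R s]` to the left of `u`, up to a constant. -/
def staircase (L R : ℕ → ℝ) (T : ℕ) (u : ℝ) : ℝ :=
  ∑ s ∈ Finset.range T, (min u (R s) - min u (L s))

lemma min_sub_min_mono {l r u v : ℝ} (h : l ≤ r) (huv : u ≤ v) :
    min u r - min u l ≤ min v r - min v l := by
  rcases min_cases u r with ⟨h1, _⟩ | ⟨h1, _⟩ <;> rcases min_cases u l with ⟨h2, _⟩ | ⟨h2, _⟩ <;>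
  rcases min_cases v r with ⟨h3, _⟩ | ⟨h3, _⟩ <;> rcases min_cases v l with ⟨h4, _⟩ | ⟨h4, _⟩ <;>
  linarith

lemma staircase_mono {L R : ℕ → ℝ} (h : ∀ s, L s ≤ R s) (T : ℕ) : Monotone (staircase L R T) :=
  fun _ _ huv => Finset.sum_le_sum fun s _ => min_sub_min_mono (h s) huv

lemma staircase_nonneg {L R : ℕ → ℝ} (h : ∀ s, L s ≤ R s) (T : ℕ) (u : ℝ) :
    0 ≤ staircase L R T u :=
  Finset.sum_nonneg fun s _ => sub_nonneg.2 (min_le_min_left u (h s))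

lemma staircase_le {L R : ℕ → ℝ} (h : ∀ s, L s ≤ R s) (T : ℕ) (u : ℝ) :
    staircase L R T u ≤ ∑ s ∈ Finset.range T, (R s - L s) :=
  Finset.sum_le_sum fun s _ => by
    have := h s
    rcases min_cases u (R s) with ⟨h1, _⟩ | ⟨h1, _⟩ <;>
    rcases min_cases u (L s) with ⟨h2, _⟩ | ⟨h2, _⟩ <;> linarith

/-- Consecutive intervals do not overlap, so the increments telescope, the gaps between them only
helping. -/
lemma staircase_sub_le {L R : ℕ → ℝ} (h' : ∀ s, R s ≤ L (s + 1)) (T : ℕ)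
    {u v : ℝ} (huv : u ≤ v) : staircase L R T v - staircase L R T u ≤ v - u := by
  have key : staircase L R T v - staircase L R T u ≤ min v (L T) - min u (L T) := by
    induction T with
    | zero => simp [staircase, huv]
    | succ T ih =>
      simp only [staircase, Finset.sum_range_succ] at ih ⊢
      linarith [min_sub_min_mono (h' T) huv]
  rcases min_cases u (L T) with ⟨h1, _⟩ | ⟨h1, _⟩ <;>
  rcases min_cases v (L T) with ⟨h2, _⟩ | ⟨h2, _⟩ <;> linarith

lemma abs_staircase_sub_le {L R : ℕ → ℝ} (h : ∀ s, L s ≤ R s) (h' : ∀ s, R s ≤ L (s + 1)) (T : ℕ)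
    (u v : ℝ) : |staircase L R T u - staircase L R T v| ≤ |u - v| := by
  wlog huv : u ≤ v generalizing u v
  · rw [abs_sub_comm, abs_sub_comm u]
    exact this v u (le_of_not_ge huv)
  rw [abs_of_nonpos (by linarith [staircase_mono h T huv]), abs_of_nonpos (by linarith)]
  linarith [staircase_sub_le h' T huv]

/-- Degenerate intervals are exempt from the ordering conditions: at early times the base points are
too close together to be separated, but no kick occurs there. -/
lemma staircase_eq {L R : ℕ → ℝ} (h : ∀ s, L s ≤ R s) {T t : ℕ} (ht : t < T) {u : ℝ}
    (hl : ∀ s < t, R s = L s ∨ R s ≤ u) (hr : ∀ s, t < s → R s = L s ∨ u ≤ L s) :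
    staircase L R T u =
      ∑ s ∈ Finset.range t, (R s - L s) + (min u (R t) - min u (L t)) := by
  have h1 : staircase L R T u = ∑ s ∈ Finset.range (t + 1), (min u (R s) - min u (L s)) := by
    symm
    apply Finset.sum_subset
    · intro i hi
      simp only [Finset.mem_range] at *
      omega
    · intro i hi hi'
      simp only [Finset.mem_range] at hi hi'
      rcases hr i (by omega) with e | e
      · rw [e, sub_self]
      · rw [min_eq_left e, min_eq_left (e.trans (h i)), sub_self]
  have h2 : ∑ s ∈ Finset.range t, (min u (R s) - min u (L s))
      = ∑ s ∈ Finset.range t, (R s - L s) := by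
    refine Finset.sum_congr rfl fun s hs => ?_
    rcases hl s (Finset.mem_range.1 hs) with e | e
    · rw [e, sub_self, sub_self]
    · rw [min_eq_right e, min_eq_right ((h s).trans e)]
  rw [h1, Finset.sum_range_succ, h2]

/-! ### The loss whose examples are all admissible slopes -/

/-- The derivatives of the convex, `β`-smooth and `G`-Lipschitz functions on the line. -/
def SlopeFunction (G β : ℝ) : Type :=
  {φ : ℝ → ℝ // Monotone φ ∧ (∀ u v, |φ u - φ v| ≤ β * |u - v|) ∧ ∀ u, |φ u| ≤ G}

/-- The loss with prescribed derivative, normalized to vanish at the origin. -/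
def slopeLoss {G β : ℝ} (w : ℝ) (z : SlopeFunction G β) : ℝ := ∫ u in (0 : ℝ)..w, z.1 u

lemma SlopeFunction.continuous {G β : ℝ} (z : SlopeFunction G β) : Continuous z.1 :=
  (LipschitzWith.of_dist_le' (K := β) fun u v => by
    simpa only [Real.dist_eq] using z.2.2.1 u v).continuous

lemma hasDerivAt_slopeLoss {G β : ℝ} (z : SlopeFunction G β) (w : ℝ) :
    HasDerivAt (fun w => slopeLoss w z) (z.1 w) w :=
  (z.continuous.integral_hasStrictDerivAt 0 w).hasDerivAt

lemma isAdmissibleLoss_slopeLoss (G β : ℝ) :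
    IsAdmissibleLoss G β (slopeLoss : ℝ → SlopeFunction G β → ℝ) := by
  intro z
  have hd : Differentiable ℝ fun w => slopeLoss w z :=
    fun w => (hasDerivAt_slopeLoss z w).differentiableAt
  have hder : deriv (fun w => slopeLoss w z) = z.1 :=
    funext fun w => (hasDerivAt_slopeLoss z w).deriv
  refine ⟨?_, ⟨hd, fun u v => ?_⟩, fun u v => ?_⟩
  · exact Monotone.convexOn_univ_of_deriv hd (hder ▸ z.2.1)
  · rw [gradient_eq_deriv', gradient_eq_deriv', hder]
    exact z.2.2.1 u v
  · exact Convex.norm_image_sub_le_of_norm_deriv_le (s := Set.univ) (fun x _ => hd x)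
      (fun x _ => by rw [hder]; exact z.2.2.2 x) convex_univ (Set.mem_univ v) (Set.mem_univ u)

lemma gradient_empiricalRisk_slopeLoss {G β : ℝ} {n : ℕ} (S : Fin n → SlopeFunction G β) (w : ℝ) :
    gradient (empiricalRisk slopeLoss S) w = 1 / (n : ℝ) * ∑ i, (S i).1 w := by
  rw [gradient_eq_deriv']
  exact ((HasDerivAt.fun_sum fun i _ => hasDerivAt_slopeLoss (S i) w).const_mul _).deriv

/-- The recursion is required only from time 1 on, since the two risks to be compared have different
gradients at the starting point. -/
lemma nag_eq_of_recursion {f : ℝ → ℝ} {x₀ η : ℝ} {T : ℕ} {x y : ℕ → ℝ}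
    (hx1 : x 1 = x₀ - η * gradient f x₀) (hy1 : y 1 = x 1)
    (hx : ∀ t, 1 ≤ t → t < T → x (t + 1) = y t - η * gradient f (y t))
    (hy : ∀ t, 1 ≤ t → t < T → y (t + 1) = x (t + 1) + nagGamma (t + 1) * (x (t + 1) - x t))
    {t : ℕ} (h1 : 1 ≤ t) (hT : t ≤ T) : nag f x₀ η t = (x t, y t) := by
  induction t, h1 using Nat.le_induction with
  | base => simp [nag, hx1, hy1, nagGamma]
  | succ t h1 ih =>
    rw [nag, ih (by omega)]
    simp only [smul_eq_mul]
    rw [← hx t h1 hT, ← hy t h1 hT]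

/-! ### Trajectories with prescribed gradients -/

/-- The iterates of NAG when the gradient met at time `t` is `-g t`. -/
def driven (g : ℕ → ℝ) (x₀ η : ℝ) : ℕ → ℝ × ℝ
  | 0 => (x₀, x₀)
  | t + 1 =>
    let x := (driven g x₀ η t).2 + η * g t
    (x, x + nagGamma (t + 1) * (x - (driven g x₀ η t).1))

/-- A persistent push makes the momentum grow linearly in spite of the factor `t / (t + 3)`; the
bound is propagated by `(t - 2) * (t + 3) ≤ t * (t + 1)`. -/
lemma driven_momentum {g : ℕ → ℝ} {x₀ η a : ℝ} (hη : 0 ≤ η) (ha : 0 ≤ a) (hg : ∀ t, a ≤ g t)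
    (t : ℕ) : η * a * ((t : ℝ) - 3) / 4 ≤ (driven g x₀ η t).2 - (driven g x₀ η t).1 := by
  induction t with
  | zero =>
    have : 0 ≤ η * a := mul_nonneg hη ha
    simp [driven]
    linarith
  | succ t ih =>
    have h0 : 0 ≤ η * a := mul_nonneg hη ha
    have h1 : η * a ≤ η * g t := mul_le_mul_of_nonneg_left (hg t) hη
    have e : (driven g x₀ η (t + 1)).2 - (driven g x₀ η (t + 1)).1
        = (t : ℝ) / (t + 3) * ((driven g x₀ η t).2 - (driven g x₀ η t).1 + η * g t) := by
      simp only [driven, nagGamma_succ]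
      ring
    have h2 : (t : ℝ) / (t + 3) * (η * a * ((t : ℝ) + 1) / 4) ≤
        (t : ℝ) / (t + 3) * ((driven g x₀ η t).2 - (driven g x₀ η t).1 + η * g t) := by
      gcongr
      linarith
    rw [e]
    refine le_trans ?_ h2
    have h3 : (t : ℝ) - 2 ≤ (t : ℝ) / (t + 3) * (t + 1) := by
      rw [div_mul_eq_mul_div, le_div_iff₀ (by positivity)]
      nlinarith
    push_cast
    nlinarith

lemma driven_gap {g : ℕ → ℝ} {x₀ η a : ℝ} (hη : 0 ≤ η) (ha : 0 ≤ a) (hg : ∀ t, a ≤ g t)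
    (t : ℕ) : η * a * ((t : ℝ) + 2) / 4 ≤ (driven g x₀ η (t + 1)).2 - (driven g x₀ η t).2 := by
  have h0 := driven_momentum (x₀ := x₀) hη ha hg (t + 1)
  have h1 : η * a ≤ η * g t := mul_le_mul_of_nonneg_left (hg t) hη
  have e : (driven g x₀ η (t + 1)).1 = (driven g x₀ η t).2 + η * g t := rfl
  push_cast at h0
  linarith

/-! ### Two unstable trajectories of one slope function -/

set_option maxHeartbeats 1000000 in
/-- There are two trajectories of NAG, driven by a common bounded smooth monotone slope `φ`, that
start a distance `δ` apart and have drifted far apart at time `T`. -/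
lemma exists_unstable_trajectories {G β η : ℝ} (x₀ : ℝ) {n T m N : ℕ} (hG : 0 < G) (hβ : 0 < β)
    (hη : 0 < η) (hηβ : η * β ≤ 1) (hn : 1 ≤ n) (hT : 1 ≤ T) (hN : 40 ≤ η * β * N)
    (hm : m = 0 ∨ (m + 2) * N ≤ T) :
    ∃ (φ : ℝ → ℝ) (x y x' y' : ℕ → ℝ) (δ : ℝ), Monotone φ ∧
      (∀ u v, |φ u - φ v| ≤ β / 2 * |u - v|) ∧ (∀ u, -(G / 2) ≤ φ u) ∧ (∀ u, φ u ≤ 0) ∧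
      0 < δ ∧ δ ≤ β * η ^ 2 * G / (4 * n) ∧ φ x₀ = -(G / 2) ∧
      x 1 = x₀ + η * (G / 2) ∧ y 1 = x 1 ∧ x' 1 = x 1 + δ ∧ y' 1 = x' 1 ∧
      (∀ t, 1 ≤ t → t < T → x (t + 1) = y t - η * φ (y t)) ∧
      (∀ t, 1 ≤ t → t < T → y (t + 1) = x (t + 1) + nagGamma (t + 1) * (x (t + 1) - x t)) ∧
      (∀ t, 1 ≤ t → t < T → x' (t + 1) = y' t - η * φ (y' t)) ∧
      (∀ t, 1 ≤ t → t < T → y' (t + 1) = x' (t + 1) + nagGamma (t + 1) * (x' (t + 1) - x' t)) ∧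
      (∀ t, 1 ≤ t → t < T → y 1 ≤ y' t) ∧
      min (G / (3 * β)) (β * η ^ 2 * G / (4 * n) * 4 ^ m) ≤ |x T - x' T| := by
  have hn0 : (0 : ℝ) < n := by exact_mod_cast hn
  have hηβ0 : 0 < η * β := by positivity
  have hNR : (40 : ℝ) ≤ N := by nlinarith [(Nat.cast_nonneg N : (0 : ℝ) ≤ N)]
  have hN40 : 40 ≤ N := by exact_mod_cast hNR
  obtain ⟨κ, hκ⟩ : ∃ κ, κ = η * β / 2 := ⟨_, rfl⟩
  have hκ0 : 0 < κ := by rw [hκ]; positivity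
  have hκ1 : κ ≤ 1 := by rw [hκ]; linarith
  have hκN : 20 ≤ κ * N := by rw [hκ]; linarith
  have hamp : IsAmplified κ N m (T - 1) m := isAmplified_final hκ0 hκ1 hN40 hκN <| by
    rcases hm with h | h
    · exact Or.inl h
    · exact Or.inr (by rw [show m + 2 = (m + 1) + 1 by ring, add_mul (m + 1)] at h; omega)
  have hkT : ∀ t, T - 1 ≤ t → kick κ N m t = 0 := fun t ht => by
    rcases hm with rfl | h
    · exact kick_of_not fun ⟨_, h2, h3⟩ => by omega
    · exact kick_eq_zero_of_gt (by rw [add_mul] at h; omega)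
  obtain ⟨D, hD⟩ : ∃ D : ℕ → ℝ, D = fun t => (deviation κ N m t).1 := ⟨_, rfl⟩
  obtain ⟨U, hU⟩ : ∃ U : ℕ → ℝ, U = fun t => (deviation κ N m t).2 := ⟨_, rfl⟩
  obtain ⟨k, hk⟩ : ∃ k : ℕ → ℝ, k = kick κ N m := ⟨_, rfl⟩
  obtain ⟨M, hM⟩ : ∃ M, M = |D (T - 1)| := ⟨_, rfl⟩
  have hM4 : 4 ^ m ≤ M := by rw [hM, hD]; exact hamp.growth
  have hM0 : 0 < M := lt_of_lt_of_le (by positivity) hM4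
  have hDM : ∀ t, t < T → |D t| ≤ M := fun t ht => by
    rw [hM, hD]; exact hamp.past t (by omega)
  have hkM : 3 * ∑ i ∈ Finset.range (T - 1), k i * |D i| ≤ κ * M := by
    rw [hM, hD, hk]; exact hamp.kicks
  have hkT' : ∀ t, T - 1 ≤ t → k t = 0 := by rw [hk]; exact hkT
  have hkcases : ∀ t, k t = 0 ∨ k t = κ := fun t => by
    rw [hk]; unfold kick; split_ifs <;> simp
  have hk0 : ∀ t, 0 ≤ k t := fun t => by rcases hkcases t with h | h <;> rw [h]; exact hκ0.le
  have hkN : ∀ t, t < N → k t = 0 := fun t ht => by rw [hk]; exact kick_eq_zero_of_lt ht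
  have hdevN : ∀ t, t ≤ N → deviation κ N m t = (1, 0) := fun t ht =>
    deviation_eq_of_forall_kick fun s hs => kick_eq_zero_of_lt (by omega)
  have hDN : ∀ t, t ≤ N → D t = 1 := fun t ht => by simp [hD, hdevN t ht]
  have hU1 : U 1 = 0 := by simp [hU, hdevN 1 (by omega)]
  have hUsucc : ∀ t, U (t + 1) = nagGamma (t + 1) * (U t - k t * D t) := fun t => by
    rw [hU, hk, hD]; rfl
  have hDsucc : ∀ t, D (t + 1) = (1 - k t) * D t + U (t + 1) := fun t => by
    rw [hU, hk, hD]; rfl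
  clear hamp hkT hdevN
  clear hD hU hk
  -- the size of the initial kink
  obtain ⟨δ, hδ⟩ : ∃ δ, δ = min (β * η ^ 2 * G / (4 * n)) (G / (3 * β) / M) := ⟨_, rfl⟩
  have hδ0 : 0 < δ := by rw [hδ]; positivity
  have hδ1 : δ ≤ β * η ^ 2 * G / (4 * n) := hδ ▸ min_le_left _ _
  -- The second term of the minimum keeps every deviation up to time `T - 1` within `G / (3β)`,
  -- whatever the amplification.
  have hδM : δ * M ≤ G / (3 * β) := by
    rw [← le_div_iff₀ hM0, hδ]; exact min_le_right _ _
  have hδlow : min (G / (3 * β)) (β * η ^ 2 * G / (4 * n) * 4 ^ m) ≤ δ * M := by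
    rw [hδ]
    rcases min_cases (β * η ^ 2 * G / (4 * n)) (G / (3 * β) / M) with ⟨h, _⟩ | ⟨h, _⟩
    · rw [h]
      exact (min_le_right _ _).trans (by gcongr)
    · rw [h, div_mul_cancel₀ _ hM0.ne']
      exact min_le_left _ _
  have hδD : ∀ t, t < T → δ * |D t| ≤ G / (3 * β) := fun t ht =>
    (mul_le_mul_of_nonneg_left (hDM t ht) hδ0.le).trans hδM
  obtain ⟨r, hr⟩ : ∃ r, r = G / (3 * β) := ⟨_, rfl⟩
  have hr0 : 0 < r := by rw [hr]; positivity
  have hrβ : β * r = G / 3 := by rw [hr]; field_simp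
  -- At a kick the half-width is exactly the deviation there, so that the other trajectory still
  -- lies in the interval where the slope is affine.
  obtain ⟨ρ, hρ⟩ : ∃ ρ : ℕ → ℝ, ρ = fun t => k t * (δ * |D t|) / κ := ⟨_, rfl⟩
  have hρ0 : ∀ t, 0 ≤ ρ t := fun t => by
    have := hk0 t
    rw [hρ]; positivity
  have hρz : ∀ t, k t = 0 → ρ t = 0 := fun t ht => by simp [hρ, ht]
  have hρκ : ∀ t, k t = κ → ρ t = δ * |D t| := fun t ht => by
    simp only [hρ, ht]; field_simp
  have hρr : ∀ t, ρ t ≤ r := fun t => by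
    rcases hkcases t with h | h
    · rw [hρz t h]; exact hr0.le
    · rw [hρκ t h, hr]
      refine hδD t ?_
      by_contra hc
      linarith [hkT' t (by omega)]
  have hρsum : ∀ t, ∑ s ∈ Finset.range t, ρ s ≤ r / 3 := by
    have h1 : ∑ s ∈ Finset.range (T - 1), ρ s ≤ r / 3 := by
      have : ∑ s ∈ Finset.range (T - 1), ρ s
          = δ / κ * ∑ s ∈ Finset.range (T - 1), k s * |D s| := by
        rw [Finset.mul_sum, hρ]
        exact Finset.sum_congr rfl fun s _ => by ring
      rw [this]
      calc δ / κ * ∑ s ∈ Finset.range (T - 1), k s * |D s|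
          ≤ δ / κ * (κ * M / 3) := by gcongr; linarith
        _ = δ * M / 3 := by field_simp
        _ ≤ r / 3 := by rw [hr]; gcongr
    intro t
    rcases le_total t (T - 1) with h | h
    · refine le_trans (Finset.sum_le_sum_of_subset_of_nonneg ?_ fun i _ _ => hρ0 i) h1
      exact Finset.range_subset_range.2 h
    · refine le_trans (le_of_eq (Eq.symm ?_)) h1
      refine Finset.sum_subset (Finset.range_subset_range.2 h) fun i _ hi => ?_
      exact hρz i (hkT' i (by simpa using hi))
  clear hkM hDM hδ
  -- the unperturbed trajectory
  obtain ⟨g, hg⟩ : ∃ g : ℕ → ℝ,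
      g = fun t => G / 2 - β / 2 * (∑ s ∈ Finset.range t, 2 * ρ s + ρ t) := ⟨_, rfl⟩
  -- The total rise of the slope is at most `β * (r / 3) = G / 9`.
  have hga : ∀ t, G / 4 ≤ g t := fun t => by
    have h1 := hρsum (t + 1)
    rw [Finset.sum_range_succ] at h1
    rw [hg]
    simp only [← Finset.mul_sum]
    nlinarith [hρ0 t]
  have hg0 : g 0 = G / 2 := by simp [hg, hρz 0 (hkN 0 (by omega))]
  obtain ⟨x, hx⟩ : ∃ x : ℕ → ℝ, x = fun t => (driven g x₀ η t).1 := ⟨_, rfl⟩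
  obtain ⟨y, hy⟩ : ∃ y : ℕ → ℝ, y = fun t => (driven g x₀ η t).2 := ⟨_, rfl⟩
  have hy0 : y 0 = x₀ := by rw [hy]; rfl
  have hxsucc : ∀ t, x (t + 1) = y t + η * g t := fun t => by rw [hx, hy]; rfl
  have hysucc : ∀ t, y (t + 1) = x (t + 1) + nagGamma (t + 1) * (x (t + 1) - x t) := fun t => by
    rw [hx, hy]; rfl
  have hy1 : y 1 = x 1 := by simp [hysucc 0, nagGamma]
  have hgap : ∀ t : ℕ, η * (G / 4) * ((t : ℝ) + 2) / 4 ≤ y (t + 1) - y t := fun t => by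
    rw [hy]; exact driven_gap hη.le (by positivity) hga t
  have hymono : Monotone y := monotone_nat_of_le_succ fun t => by
    have : 0 ≤ η * (G / 4) * ((t : ℝ) + 2) / 4 := by positivity
    linarith [hgap t]
  have hgapN : ∀ t, N ≤ t + 1 → 2 * r ≤ y (t + 1) - y t := fun t ht => by
    refine le_trans ?_ (hgap t)
    have h1 : (N : ℝ) ≤ t + 1 := by exact_mod_cast ht
    have h2 : η * β * N ≤ η * β * (t + 2) := by gcongr; linarith
    have h3 : 40 * G ≤ η * β * (t + 2) * G := by nlinarith
    rw [hr, mul_div_assoc', div_le_iff₀ (by positivity)]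
    nlinarith
  have hsep : ∀ s t, s < t → N ≤ t → 2 * r ≤ y t - y s := fun s t hst ht => by
    obtain ⟨t, rfl⟩ : ∃ t', t = t' + 1 := ⟨t - 1, by omega⟩
    linarith [hgapN t ht, hymono (by omega : s ≤ t)]
  clear hx hy hgap hgapN
  -- the common slope function
  obtain ⟨L, hL⟩ : ∃ L : ℕ → ℝ, L = fun t => y t - ρ t := ⟨_, rfl⟩
  obtain ⟨R, hR⟩ : ∃ R : ℕ → ℝ, R = fun t => y t + ρ t := ⟨_, rfl⟩
  have hLR : ∀ t, L t ≤ R t := fun t => by rw [hL, hR]; linarith [hρ0 t]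
  have hRL : ∀ t, R t ≤ L (t + 1) := fun t => by
    rw [hL, hR]
    simp only
    by_cases h : N ≤ t + 1
    · linarith [hsep t (t + 1) (by omega) h, hρr t, hρr (t + 1)]
    · rw [hρz t (hkN t (by omega)), hρz (t + 1) (hkN _ (by omega))]
      linarith [hymono (by omega : t ≤ t + 1)]
  obtain ⟨φ, hφ⟩ : ∃ φ : ℝ → ℝ, φ = fun u => -(G / 2) + β / 2 * staircase L R T u := ⟨_, rfl⟩
  have hφmono : Monotone φ := fun u v huv => by
    rw [hφ]
    have := staircase_mono hLR T huv
    simp only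
    gcongr
  have hφlip : ∀ u v, |φ u - φ v| ≤ β / 2 * |u - v| := fun u v => by
    have : φ u - φ v = β / 2 * (staircase L R T u - staircase L R T v) := by
      rw [hφ]; ring
    rw [this, abs_mul, abs_of_pos (by positivity : 0 < β / 2)]
    exact mul_le_mul_of_nonneg_left (abs_staircase_sub_le hLR hRL T u v) (by positivity)
  have hφlow : ∀ u, -(G / 2) ≤ φ u := fun u => by
    have := staircase_nonneg hLR T u
    rw [hφ]
    simp only
    have : 0 ≤ β / 2 * staircase L R T u := by positivity
    linarith
  have hφup : ∀ u, φ u ≤ 0 := fun u => by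
    have h1 := staircase_le (L := L) (R := R) hLR T u
    have h2 : ∑ s ∈ Finset.range T, (R s - L s) = 2 * ∑ s ∈ Finset.range T, ρ s := by
      rw [Finset.mul_sum, hL, hR]
      exact Finset.sum_congr rfl fun s _ => by ring
    have h3 := hρsum T
    have h4 : staircase L R T u ≤ 2 * (r / 3) := by linarith
    rw [hφ]
    simp only
    nlinarith
  -- This closes the loop: both trajectories meet the gradients prescribed in advance. At a kick, `k
  -- t / η` is the curvature `β / 2`.
  have hφy : ∀ t, t < T → ∀ d, |d| ≤ δ * |D t| → φ (y t + d) = -g t + k t / η * d := by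
    intro t ht d hd
    have hdr : |d| ≤ r := hd.trans (by rw [hr]; exact hδD t ht)
    obtain ⟨hd1, hd2⟩ := abs_le.1 hdr
    have hs : staircase L R T (y t + d) = ∑ s ∈ Finset.range t, (R s - L s) +
        (min (y t + d) (R t) - min (y t + d) (L t)) := by
      refine staircase_eq hLR ht (fun s hs => ?_) fun s hs => ?_
      · rw [hR, hL]
        by_cases h : N ≤ s
        · exact Or.inr (by simp only; linarith [hsep s t hs (by omega), hρr s])
        · exact Or.inl (by simp [hρz s (hkN s (by omega))])
      · rw [hR, hL]
        by_cases h : N ≤ s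
        · exact Or.inr (by simp only; linarith [hsep t s hs h, hρr s])
        · exact Or.inl (by simp [hρz s (hkN s (by omega))])
    have h2 : ∑ s ∈ Finset.range t, (R s - L s) = ∑ s ∈ Finset.range t, 2 * ρ s := by
      rw [hL, hR]
      exact Finset.sum_congr rfl fun s _ => by ring
    simp only [hφ, hg, hs, h2]
    rcases hkcases t with h | h
    · simp [hR, hL, hρz t h, h]
      ring
    · have h3 := hρκ t h
      obtain ⟨hd3, hd4⟩ := abs_le.1 (h3 ▸ hd)
      rw [h, min_eq_left (by rw [hR]; simp only; linarith),
        min_eq_right (by rw [hL]; simp only; linarith), hL, hκ]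
      simp only
      field_simp
      ring
  clear hφ hg hL hR hLR hRL
  have hφ0 : ∀ t, t < T → φ (y t) = -g t := fun t ht => by
    simpa using hφy t ht 0 (by simpa using by positivity)
  refine ⟨φ, x, y, fun t => x t + δ * (D t - U t), fun t => y t + δ * D t, δ, hφmono, hφlip, hφlow,
    hφup, hδ0, hδ1, by rw [← hy0, hφ0 0 hT, hg0], by rw [hxsucc, hy0, hg0], hy1,
    by simp [hDN 1 (by omega), hU1], by simp [hy1, hU1],
    fun t _ ht => by rw [hφ0 t ht, hxsucc]; ring, fun t _ _ => hysucc t, ?_, ?_, ?_, ?_⟩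
  · intro t _ ht
    simp only
    rw [hφy t ht _ (by rw [abs_mul, abs_of_pos hδ0]), hxsucc, hDsucc]
    field_simp
    ring
  · intro t _ _
    simp only
    rw [hysucc, hDsucc, hUsucc]
    ring
  -- The second trajectory never returns to the left of `y 1`: before the first kick its deviation
  -- is positive, and later the base point is at least `2 * r` ahead while the deviation is at most
  -- `r`.
  · intro t h1 ht
    simp only
    by_cases h : N ≤ t
    · have h2 := hδD t ht
      rw [← hr] at h2
      nlinarith [hsep 1 t (by omega) h, neg_abs_le (D t)]
    · rw [hDN t (by omega)]
      linarith [hymono h1]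
  · obtain ⟨T, rfl⟩ : ∃ T', T = T' + 1 := ⟨T - 1, by omega⟩
    -- No kick occurs in the last step, so the deviation of the last `x` is that of the preceding
    -- `y`.
    have h1 : D (T + 1) - U (T + 1) = D T := by
      rw [hDsucc, hkT' T (by simp)]; ring
    simp only
    rw [h1, sub_add_cancel_left, abs_neg, abs_mul, abs_of_pos hδ0]
    simpa [hM] using hδlow

/-! ### From trajectories to samples and stability -/

/-- Adding a kink of height `n * δ / η` to one of `n` equal losses, where only the gradient at the
starting point sees it, switches between two unstable trajectories. -/
lemma exists_samples {G β η : ℝ} (x₀ : ℝ) {n T m N : ℕ} (hG : 0 < G) (hβ : 0 < β) (hη : 0 < η)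
    (hηβ : η * β ≤ 1) (hn : 1 ≤ n) (hT : 1 ≤ T) (hN : 40 ≤ η * β * N)
    (hm : m = 0 ∨ (m + 2) * N ≤ T) :
    ∃ S S' : Fin n → SlopeFunction G β, {i | S i ≠ S' i}.Subsingleton ∧
      min (G / (3 * β)) (β * η ^ 2 * G / (4 * n) * 4 ^ m) ≤
        |fullBatchNAG slopeLoss x₀ η T S - fullBatchNAG slopeLoss x₀ η T S'| := by
  have hn0 : (0 : ℝ) < n := by exact_mod_cast hn
  obtain ⟨φ, x, y, x', y', δ, hφmono, hφlip, hφlow, hφup, hδ0, hδ1, hφx, hx1, hy1, hx1', hy1', hx,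
    hy, hx', hy', hyy', hxx'⟩ := exists_unstable_trajectories x₀ hG hβ hη hηβ hn hT hN hm
  -- Averaged over `n` examples and multiplied by `η`, this height shifts the first iterate by `δ`.
  obtain ⟨c, hc⟩ : ∃ c, c = n * δ / η := ⟨_, rfl⟩
  have hc0 : 0 ≤ c := by rw [hc]; positivity
  have hcG : c ≤ β * η * G / 4 := by
    have h1 := hδ1
    rw [le_div_iff₀ (by positivity)] at h1
    rw [hc, div_le_iff₀ hη]
    linarith
  -- Slope `β / 2` is what `φ` leaves of the smoothness budget. Descending to zero at `y 1`, the
  -- kink has room for height `β / 2 * (y 1 - x₀) = β * η * G / 4` at `x₀`, which is the origin of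
  -- the bound on `δ`.
  obtain ⟨q, hq⟩ : ∃ q : ℝ → ℝ, q = fun u => -max (min c (β / 2 * (y 1 - u))) 0 := ⟨_, rfl⟩
  have hqmono : Monotone q := fun u v huv => by
    rw [hq]
    simp only
    gcongr
  have hqlip : ∀ u v, |q u - q v| ≤ β / 2 * |u - v| := fun u v => by
    have h1 : q u - q v = max (min c (β / 2 * (y 1 - v))) 0 - max (min c (β / 2 * (y 1 - u))) 0 := by
      rw [hq]; ring
    have h2 : β / 2 * (y 1 - v) - β / 2 * (y 1 - u) = β / 2 * (u - v) := by ring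
    rw [h1, ← abs_of_pos (by positivity : 0 < β / 2), ← abs_mul, abs_of_pos (by positivity : 0 < β / 2),
      ← h2, min_comm c, min_comm c]
    exact (abs_max_sub_max_le_abs _ _ _).trans (abs_inf_sub_inf_le_abs _ _ _)
  have hqlow : ∀ u, -(G / 4) ≤ q u := fun u => by
    have h1 : max (min c (β / 2 * (y 1 - u))) 0 ≤ c := max_le (min_le_left _ _) hc0
    have h2 : β * η * G ≤ G := by nlinarith
    rw [hq]
    simp only
    linarith
  have hqup : ∀ u, q u ≤ 0 := fun u => by
    rw [hq]
    exact neg_nonpos.2 (le_max_right _ _)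
  have hqx : q x₀ = -c := by
    have h1 : β / 2 * (y 1 - x₀) = β * η * G / 4 := by
      rw [hy1, hx1]; ring
    rw [hq]
    simp only [h1]
    rw [min_eq_left hcG, max_eq_left hc0]
  have hqz : ∀ u, y 1 ≤ u → q u = 0 := fun u hu => by
    rw [hq]
    simp only
    rw [max_eq_right ((min_le_right _ _).trans (by nlinarith)), neg_zero]
  clear hq
  let z : SlopeFunction G β := ⟨φ, hφmono, fun u v => (hφlip u v).trans (by
    have := abs_nonneg (u - v); nlinarith), fun u => by
    rw [abs_le]; constructor <;> linarith [hφlow u, hφup u]⟩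
  let z' : SlopeFunction G β := ⟨fun u => φ u + q u, hφmono.add hqmono, fun u v => by
    have h1 : φ u + q u - (φ v + q v) = (φ u - φ v) + (q u - q v) := by ring
    rw [h1]
    linarith [abs_add_le (φ u - φ v) (q u - q v), hφlip u v, hqlip u v], fun u => by
    rw [abs_le]; constructor <;> linarith [hφlow u, hφup u, hqlow u, hqup u]⟩
  let i₀ : Fin n := ⟨0, hn⟩
  let S : Fin n → SlopeFunction G β := fun _ => z
  let S' : Fin n → SlopeFunction G β := Function.update S i₀ z'
  have hgrad : ∀ w, gradient (empiricalRisk slopeLoss S) w = φ w := fun w => by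
    rw [gradient_empiricalRisk_slopeLoss]
    simp only [S, z, Finset.sum_const, Finset.card_univ, Fintype.card_fin, nsmul_eq_mul]
    field_simp
  have hgrad' : ∀ w, gradient (empiricalRisk slopeLoss S') w = φ w + q w / n := fun w => by
    have h1 : ∀ i, (S' i).1 w = φ w + if i = i₀ then q w else 0 := fun i => by
      by_cases h : i = i₀
      · have e : S' i = z' := by rw [h]; exact Function.update_self ..
        rw [e, if_pos h]
      · have e : S' i = z := Function.update_of_ne h ..
        rw [e, if_neg h, add_zero]
    rw [gradient_empiricalRisk_slopeLoss]
    simp only [h1, Finset.sum_add_distrib, Finset.sum_const, Finset.card_univ, Fintype.card_fin,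
      nsmul_eq_mul, Finset.sum_ite_eq', Finset.mem_univ, if_true]
    field_simp
  have hxT : fullBatchNAG slopeLoss x₀ η T S = x T := by
    rw [fullBatchNAG, nag_eq_of_recursion (T := T) (x := x) (y := y)
      (by rw [hgrad, hφx, hx1]; ring) hy1 (fun t h1 ht => by rw [hgrad, hx t h1 ht]) hy hT le_rfl]
  have hxT' : fullBatchNAG slopeLoss x₀ η T S' = x' T := by
    rw [fullBatchNAG, nag_eq_of_recursion (T := T) (x := x') (y := y')
      (by rw [hgrad', hφx, hqx, hx1', hx1, hc]; field_simp; ring) hy1'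
      (fun t h1 ht => by rw [hgrad', hqz _ (hyy' t h1 ht), hx' t h1 ht, zero_div, add_zero]) hy' hT
      le_rfl]
  refine ⟨S, S', ?_, by rwa [hxT, hxT']⟩
  intro i hi j hj
  have h : ∀ i, S i ≠ S' i → i = i₀ := fun i hi => by
    by_contra hne
    exact hi (by simp [S', hne])
  rw [h i hi, h j hj]

lemma le_uniformStability {E Z : Type*} {n : ℕ} {ℓ : E → Z → ℝ} {A : (Fin n → Z) → E} {a : ℝ}
    {S S' : Fin n → Z} (hS : {i | S i ≠ S' i}.Subsingleton) (z : Z)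
    (h : a ≤ |ℓ (A S) z - ℓ (A S') z|) : (a : EReal) ≤ uniformStability ℓ A := by
  refine le_sInf ?_
  rintro _ ⟨ε, ⟨_, hε⟩, rfl⟩
  exact EReal.coe_le_coe_iff.2 (h.trans (hε S S' hS z))

lemma le_uniformStability_slopeLoss {G β η : ℝ} (x₀ : ℝ) {n T m N : ℕ} (hG : 0 < G) (hβ : 0 < β)
    (hη : 0 < η) (hηβ : η * β ≤ 1) (hn : 1 ≤ n) (hT : 1 ≤ T) (hN : 40 ≤ η * β * N)
    (hm : m = 0 ∨ (m + 2) * N ≤ T) {a : ℝ}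
    (ha : a ≤ min (G ^ 2 / (3 * β)) (β * η ^ 2 * G ^ 2 / (4 * n) * 4 ^ m)) :
    (a : EReal) ≤ uniformStability (n := n) (slopeLoss : ℝ → SlopeFunction G β → ℝ)
      (fullBatchNAG slopeLoss x₀ η T) := by
  obtain ⟨S, S', hS, h⟩ := exists_samples x₀ hG hβ hη hηβ hn hT hN hm
  let z : SlopeFunction G β := ⟨fun _ => G, monotone_const, fun u v => by
    simpa using mul_nonneg hβ.le (abs_nonneg (u - v)), fun _ => (abs_of_pos hG).le⟩
  have hz : ∀ w, slopeLoss w z = w * G := fun w => by simp [slopeLoss, z]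
  refine le_uniformStability hS z ?_
  rw [hz, hz, ← sub_mul, abs_mul, abs_of_pos hG]
  refine (ha.trans_eq ?_).trans (mul_le_mul_of_nonneg_right h hG.le)
  rw [min_mul_of_nonneg _ _ hG.le]
  congr 1 <;> ring

/-! ### Explicit rates -/

/-- The amplification by `4` in each of the periods of length `N` but the first and the last
ones. -/
lemma exp_le_four_pow {N T : ℕ} (hN : 0 < N) {a : ℝ} (h : a ≤ T / N - 3) :
    Real.exp a ≤ 4 ^ (T / N - 2) := by
  have h1 : (T : ℝ) / N < (T / N : ℕ) + 1 := by
    rw [div_lt_iff₀ (by exact_mod_cast hN)]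
    rw [mul_comm]
    exact_mod_cast Nat.lt_mul_div_succ T hN
  have h2 : ((T / N : ℕ) : ℝ) ≤ (T / N - 2 : ℕ) + 2 := by exact_mod_cast le_tsub_add
  calc Real.exp a ≤ Real.exp ((T / N - 2 : ℕ) * 1) := Real.exp_le_exp.2 (by linarith)
    _ = Real.exp 1 ^ (T / N - 2) := by rw [Real.exp_nat_mul]
    _ ≤ 4 ^ (T / N - 2) := by
        gcongr
        linarith [Real.exp_one_lt_d9]

lemma sub_two_eq_zero_or_mul_le (N T : ℕ) : T / N - 2 = 0 ∨ (T / N - 2 + 2) * N ≤ T := by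
  rcases Nat.lt_or_ge (T / N) 2 with h | h
  · left; omega
  · right
    rw [Nat.sub_add_cancel h]
    exact Nat.div_mul_le_self T N

/-- The period `N = ⌈40 / (ηβ)⌉` satisfies `ηβN ≤ 41`, whence the rate `1/41`. The factor `exp (-3)`
pays for the first and last periods and for rounding, and `1/4` is inherited from the size of the
initial kink. -/
lemma exp_le_uniformStability {G β η : ℝ} (x₀ : ℝ) {n T : ℕ} (hG : 0 < G) (hβ : 0 < β)
    (hη : 0 < η) (hηβ : η * β ≤ 1) (hn : 1 ≤ n) (hT : 1 ≤ T) :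
    ((min (G ^ 2 / (3 * β)) (Real.exp (-3) / 4 * Real.exp (1 / 41 * η * β * (T : ℝ)) *
        (β * η ^ 2 * G ^ 2 / (n : ℝ))) : ℝ) : EReal)
      ≤ uniformStability (n := n) (slopeLoss : ℝ → SlopeFunction G β → ℝ)
          (fullBatchNAG slopeLoss x₀ η T) := by
  have hηβ0 : 0 < η * β := by positivity
  have hN0 : 0 < ⌈40 / (η * β)⌉₊ := Nat.ceil_pos.2 (by positivity)
  have hN0' : (0 : ℝ) < ⌈40 / (η * β)⌉₊ := by exact_mod_cast hN0
  have hN1 : 40 / (η * β) ≤ ⌈40 / (η * β)⌉₊ := Nat.le_ceil _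
  have hN2 : (⌈40 / (η * β)⌉₊ : ℝ) < 40 / (η * β) + 1 := Nat.ceil_lt_add_one (by positivity)
  refine le_uniformStability_slopeLoss x₀ hG hβ hη hηβ hn hT (N := ⌈40 / (η * β)⌉₊)
    (m := T / ⌈40 / (η * β)⌉₊ - 2) (by rw [div_le_iff₀ hηβ0] at hN1; linarith)
    (sub_two_eq_zero_or_mul_le _ _) (min_le_min le_rfl ?_)
  have hN3 : η * β * ⌈40 / (η * β)⌉₊ ≤ 41 := by
    have h : η * β * (40 / (η * β) + 1) = 40 + η * β := by field_simp
    nlinarith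
  have h : 1 / 41 * η * β * (T : ℝ) - 3 ≤ T / ⌈40 / (η * β)⌉₊ - 3 := by
    rw [sub_le_sub_iff_right, le_div_iff₀ hN0']
    have : (0 : ℝ) ≤ T := Nat.cast_nonneg T
    nlinarith
  have h1 := exp_le_four_pow hN0 h
  rw [sub_eq_neg_add, Real.exp_add] at h1
  calc _ = β * η ^ 2 * G ^ 2 / (4 * n) *
        (Real.exp (-3) * Real.exp (1 / 41 * η * β * (T : ℝ))) := by ring
    _ ≤ _ := by gcongr

/-- For such `T` the amplification is at least `6n / (η²β²)`, which cancels the smallness of the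
initial deviation. -/
lemma le_uniformStability_of_log_le {G β η : ℝ} (x₀ : ℝ) {n T : ℕ} (hG : 0 < G) (hβ : 0 < β)
    (hη : 0 < η) (hηβ : η * β ≤ 1) (hn : 1 ≤ n)
    (hT : (⌈40 / (η * β)⌉₊ : ℝ) * (Real.log (6 * (n : ℝ) / (η ^ 2 * β ^ 2)) + 3) ≤ (T : ℝ)) :
    ((G ^ 2 / (3 * β) : ℝ) : EReal) ≤
      uniformStability (n := n) (slopeLoss : ℝ → SlopeFunction G β → ℝ)
          (fullBatchNAG slopeLoss x₀ η T) := by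
  have hηβ0 : 0 < η * β := by positivity
  have hn' : (1 : ℝ) ≤ n := by exact_mod_cast hn
  have hN0 : 0 < ⌈40 / (η * β)⌉₊ := Nat.ceil_pos.2 (by positivity)
  have hN0' : (0 : ℝ) < ⌈40 / (η * β)⌉₊ := by exact_mod_cast hN0
  have hN1 : 40 / (η * β) ≤ ⌈40 / (η * β)⌉₊ := Nat.le_ceil _
  have hX0 : 0 < 6 * (n : ℝ) / (η ^ 2 * β ^ 2) := by positivity
  have hlog : 0 ≤ Real.log (6 * (n : ℝ) / (η ^ 2 * β ^ 2)) := by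
    refine Real.log_nonneg ?_
    rw [le_div_iff₀ (by positivity)]
    nlinarith
  have hT1 : 1 ≤ T := by
    have : (0 : ℝ) < T := lt_of_lt_of_le (by positivity) hT
    exact_mod_cast this
  have h1 : Real.log (6 * (n : ℝ) / (η ^ 2 * β ^ 2)) ≤ T / ⌈40 / (η * β)⌉₊ - 3 := by
    rw [le_sub_iff_add_le, le_div_iff₀ hN0']
    linarith
  have h2 := exp_le_four_pow hN0 h1
  rw [Real.exp_log hX0] at h2
  refine le_uniformStability_slopeLoss x₀ hG hβ hη hηβ hn hT1 (N := ⌈40 / (η * β)⌉₊)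
    (m := T / ⌈40 / (η * β)⌉₊ - 2) (by rw [div_le_iff₀ hηβ0] at hN1; linarith)
    (sub_two_eq_zero_or_mul_le _ _) (le_min le_rfl ?_)
  calc G ^ 2 / (3 * β) ≤ 3 / 2 * (G ^ 2 / β) := by
        have : 0 < G ^ 2 / β := by positivity
        have e : G ^ 2 / (3 * β) = 1 / 3 * (G ^ 2 / β) := by ring
        linarith
    _ = β * η ^ 2 * G ^ 2 / (4 * n) * (6 * (n : ℝ) / (η ^ 2 * β ^ 2)) := by
        field_simp
        norm_num
    _ ≤ _ := by gcongr

/-- With `n = 4 ^ k` and `T` proportional to `k + 1`, the stability stays above `G² / (3β)` while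
`T² / n` tends to zero. -/
lemma not_forall_uniformStability_le {G β η : ℝ} (x₀ : ℝ) (hG : 0 < G) (hβ : 0 < β)
    (hη : 0 < η) (hηβ : η * β ≤ 1) (C : ℝ) :
    ∃ n T : ℕ, 1 ≤ n ∧ 1 ≤ T ∧
      ¬ uniformStability (n := n) (slopeLoss : ℝ → SlopeFunction G β → ℝ)
          (fullBatchNAG slopeLoss x₀ η T) ≤ ((C * (T : ℝ) ^ 2 / (n : ℝ) : ℝ) : EReal) := by
  obtain ⟨B, hB⟩ := exists_nat_ge
    (⌈40 / (η * β)⌉₊ * (|Real.log (6 / (η ^ 2 * β ^ 2))| + 5) : ℝ)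
  have hN0' : (0 : ℝ) < ⌈40 / (η * β)⌉₊ := by
    exact_mod_cast Nat.ceil_pos.2 (by positivity : 0 < 40 / (η * β))
  have hBpos : (0 : ℝ) < B := lt_of_lt_of_le (by positivity) hB
  have hlim : Filter.Tendsto (fun k : ℕ => C * B ^ 2 * 4 * ((k + 1 : ℕ) ^ 2 * (1 / 4 : ℝ) ^ (k + 1)))
      Filter.atTop (nhds (C * B ^ 2 * 4 * 0)) :=
    ((tendsto_pow_const_mul_const_pow_of_abs_lt_one 2
      (by norm_num [abs_of_pos] : |(1 / 4 : ℝ)| < 1)).comp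
        (Filter.tendsto_add_atTop_nat 1)).const_mul _
  rw [mul_zero] at hlim
  obtain ⟨k, hk⟩ := (hlim.eventually (gt_mem_nhds (by positivity : 0 < G ^ 2 / (3 * β)))).exists
  refine ⟨4 ^ k, B * (k + 1), Nat.one_le_pow _ _ (by norm_num), ?_, fun hle => ?_⟩
  · have : 0 < B := by exact_mod_cast hBpos
    exact Nat.mul_pos this (by omega)
  have hlow := le_uniformStability_of_log_le x₀ hG hβ hη hηβ (n := 4 ^ k) (T := B * (k + 1))
    (Nat.one_le_pow _ _ (by norm_num)) (by
      have h4 : Real.log 4 ≤ 2 := by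
        have : Real.log 4 = 2 * Real.log 2 := by
          rw [show (4 : ℝ) = 2 ^ 2 by norm_num, Real.log_pow]; norm_num
        linarith [Real.log_two_lt_d9]
      have hlog : Real.log (6 * ((4 ^ k : ℕ) : ℝ) / (η ^ 2 * β ^ 2))
          = Real.log (6 / (η ^ 2 * β ^ 2)) + k * Real.log 4 := by
        push_cast
        rw [mul_div_right_comm, Real.log_mul (by positivity) (by positivity), Real.log_pow]
      rw [hlog]
      push_cast
      have hk0 : (0 : ℝ) ≤ k := Nat.cast_nonneg k
      have h5 := le_abs_self (Real.log (6 / (η ^ 2 * β ^ 2)))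
      have h6 := abs_nonneg (Real.log (6 / (η ^ 2 * β ^ 2)))
      calc _ ≤ (⌈40 / (η * β)⌉₊ : ℝ) *
            ((|Real.log (6 / (η ^ 2 * β ^ 2))| + 5) * ((k : ℝ) + 1)) := by
              gcongr
              nlinarith
        _ ≤ _ := by
              rw [← mul_assoc]
              gcongr)
  have h := EReal.coe_le_coe_iff.1 (hlow.trans hle)
  refine absurd (h.trans_eq ?_) (not_le.2 hk)
  push_cast
  rw [one_div, inv_pow]
  field_simp
  ring

end

theorem mainTheorem2 :
    (∃ c₃ c₄ : ℝ, 0 < c₃ ∧ 0 < c₄ ∧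
      ∀ (G β η x₀ : ℝ) (n : ℕ), 0 < G → 0 < β → 0 < η → η ≤ 1 / β → 4 ≤ n →
        ∃ (Z : Type) (ℓ : ℝ → Z → ℝ), IsAdmissibleLoss G β ℓ ∧
          (∀ T : ℕ,
            (∃ i : ℕ, 1 ≤ i ∧ T = ⌈10 / (η * β) * ((n : ℝ) / ((n : ℝ) - 3))⌉₊ * (i + 2)) →
            ((min (G ^ 2 / (3 * β))
                (c₄ * Real.exp (c₃ * η * β * (T : ℝ)) * (β * η ^ 2 * G ^ 2 / (n : ℝ))) : ℝ) : EReal)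
              ≤ uniformStability (n := n) ℓ (fullBatchNAG ℓ x₀ η T)) ∧
          (∀ T : ℕ,
            (⌈40 / (η * β)⌉₊ : ℝ) * (Real.log (6 * (n : ℝ) / (η ^ 2 * β ^ 2)) + 3) ≤ (T : ℝ) →
            ((G ^ 2 / (3 * β) : ℝ) : EReal)
              ≤ uniformStability (n := n) ℓ (fullBatchNAG ℓ x₀ η T))) ∧
    (∀ G β η x₀ : ℝ, 0 < G → 0 < β → 0 < η → η ≤ 1 / β →
      ¬ ∃ C : ℝ, ∀ (n T : ℕ), 1 ≤ n → 1 ≤ T →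
        ∀ (Z : Type) (ℓ : ℝ → Z → ℝ), IsAdmissibleLoss G β ℓ →
          uniformStability (n := n) ℓ (fullBatchNAG ℓ x₀ η T)
            ≤ ((C * (T : ℝ) ^ 2 / (n : ℝ) : ℝ) : EReal)) := by
  refine ⟨⟨1 / 41, Real.exp (-3) / 4, by norm_num, by positivity, ?_⟩, ?_⟩
  · intro G β η x₀ n hG hβ hη hηβ hn
    rw [le_div_iff₀ hβ] at hηβ
    have hn0 : (0 : ℝ) < (n : ℝ) - 3 := by
      have : (4 : ℝ) ≤ n := by exact_mod_cast hn
      linarith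
    refine ⟨SlopeFunction G β, slopeLoss, isAdmissibleLoss_slopeLoss G β, ?_, fun T hT =>
      le_uniformStability_of_log_le x₀ hG hβ hη hηβ (by omega) hT⟩
    rintro T ⟨i, _, rfl⟩
    refine exp_le_uniformStability x₀ hG hβ hη hηβ (by omega) (Nat.mul_pos ?_ (by omega))
    have : (0 : ℝ) < n := by linarith
    exact Nat.ceil_pos.2 (by positivity)
  · rintro G β η x₀ hG hβ hη hηβ ⟨C, hC⟩
    rw [le_div_iff₀ hβ] at hηβ
    obtain ⟨n, T, hn, hT, h⟩ := not_forall_uniformStability_le x₀ hG hβ hη hηβ C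
    exact h (hC n T hn hT _ _ (isAdmissibleLoss_slopeLoss G β))
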